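/- Let $(M,g)$ be a complete (connected, smooth, boundaryless) $n$-dimensional Riemannian manifold with its Levi-Civita connection, and let $p\in M$. For $x\in M$ let $G_p^x\subset T_pM$ be the set of initial velocities $\gamma'(0)$ of length minimizing geodesics $\gamma:[0,1]\to M$ with $\gamma(0)=p$ and $\gamma(1)=x$. A direction function at $p$ is a map $\eta_p:M\to T_pM$ with $\eta_p(x)\in G_p^x$ for every $x\in M$. Given $\eta_p$ and $r\in(0,1]$, the $r$-radial contraction based at $p$ with respect to $\eta_p$ is the map $C_p^r:M\to M$, $C_p^r(x)=\gamma_{px}(r)$, where $\gamma_{px}:[0,1]\to M$ is the length minimizing geodesic from $p$ to $x$ with $\gamma_{px}'(0)=\eta_p(x)$. Then for every direction function $\eta_p$ at $p$, all $\lambda,\beta\in(0,1]$ and every $x\in M$, $$C^\lambda_p\bigl(C^\beta_p(x)\bigr)=C^{\lambda\beta}_p(x).$$ -/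

import Mathlib

open scoped Manifold ContDiff Bundle

noncomputable section

namespace RadialContraction

section Coordinates

variable {n : ℕ} {M : Type*} [TopologicalSpace M] [ChartedSpace (EuclideanSpace ℝ (Fin n)) M]

/-- The coordinate vector field `∂ᵢ` of the chart `chartAt _ c` around `c`, at the point with
coordinates `y`: the image of the `i`-th standard basis vector under the differential of the
inverse chart. -/
def coordVector (c : M) (i : Fin n) (y : EuclideanSpace ℝ (Fin n)) :
    TangentSpace (𝓡 n) ((extChartAt (𝓡 n) c).symm y) :=
  mfderiv (𝓡 n) (𝓡 n) (extChartAt (𝓡 n) c).symm y (EuclideanSpace.single i (1 : ℝ))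

/-- The partial derivative `∂f/∂yⁱ` of a function of the coordinates. -/
def partialDeriv (i : Fin n) (f : EuclideanSpace ℝ (Fin n) → ℝ)
    (y : EuclideanSpace ℝ (Fin n)) : ℝ :=
  fderiv ℝ f y (EuclideanSpace.single i (1 : ℝ))

variable [Bundle.RiemannianBundle (fun x : M ↦ TangentSpace (𝓡 n) x)]

/-- The coefficients `g_ij = g(∂ᵢ, ∂ⱼ)` of the metric in the chart around `c`. -/
def metricMatrix (c : M) (y : EuclideanSpace ℝ (Fin n)) : Matrix (Fin n) (Fin n) ℝ :=
  Matrix.of fun i j ↦ inner ℝ (coordVector c i y) (coordVector c j y)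

/-- The Christoffel symbols `Γᵏ_ij = ½ ∑_l gᵏˡ (∂ᵢ g_jl + ∂ⱼ g_il - ∂_l g_ij)` of the
Levi-Civita connection in the chart around `c`. -/
def christoffel (c : M) (k i j : Fin n) (y : EuclideanSpace ℝ (Fin n)) : ℝ :=
  (1 / 2 : ℝ) * ∑ l, (metricMatrix c y)⁻¹ k l *
    (partialDeriv i (fun z ↦ metricMatrix c z j l) y
      + partialDeriv j (fun z ↦ metricMatrix c z i l) y
      - partialDeriv l (fun z ↦ metricMatrix c z i j) y)

end Coordinates

section Geodesics

variable {n : ℕ} {M : Type*} [TopologicalSpace M] [ChartedSpace (EuclideanSpace ℝ (Fin n)) M]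

/-- The coordinate expression of the curve `γ` in the chart around `c`. -/
def coordCurve (c : M) (γ : ℝ → M) (t : ℝ) : EuclideanSpace ℝ (Fin n) :=
  extChartAt (𝓡 n) c (γ t)

/-- The velocity `γ'(t)` of a curve on `[0,1]` (one-sided at the end points), together with its
base point `γ(t)`. -/
def velocity (n : ℕ) {M : Type*} [TopologicalSpace M]
    [ChartedSpace (EuclideanSpace ℝ (Fin n)) M] (γ : ℝ → M) (t : ℝ) : TangentBundle (𝓡 n) M :=
  ⟨γ t, mfderivWithin 𝓘(ℝ, ℝ) (𝓡 n) γ (Set.Icc 0 1) t (1 : ℝ)⟩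

variable [Bundle.RiemannianBundle (fun x : M ↦ TangentSpace (𝓡 n) x)]

/-- `γ : [0,1] → M` is a geodesic of the Levi-Civita connection, `∇_{γ'} γ' = 0`: it is smooth and
satisfies `(uᵏ)'' + ∑ Γᵏ_ij (uⁱ)' (uʲ)' = 0` in every chart. Only the values of `γ` on `[0,1]`
matter. -/
structure IsGeodesic (n : ℕ) {M : Type*} [TopologicalSpace M]
    [ChartedSpace (EuclideanSpace ℝ (Fin n)) M]
    [Bundle.RiemannianBundle (fun x : M ↦ TangentSpace (𝓡 n) x)] (γ : ℝ → M) : Prop where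
  smooth : ContMDiffOn 𝓘(ℝ, ℝ) (𝓡 n) ∞ γ (Set.Icc 0 1)
  equation : ∀ c : M, ∀ t ∈ Set.Icc (0 : ℝ) 1, γ t ∈ (extChartAt (𝓡 n) c).source → ∀ k : Fin n,
    (derivWithin (derivWithin (coordCurve c γ) (Set.Icc 0 1)) (Set.Icc 0 1) t) k
      + ∑ i, ∑ j, christoffel c k i j (coordCurve c γ t)
          * (derivWithin (coordCurve c γ) (Set.Icc 0 1) t) i
          * (derivWithin (coordCurve c γ) (Set.Icc 0 1) t) j = 0

/-- `γ : [0,1] → M` is a length minimizing geodesic from `x` to `y`. -/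
structure IsMinimizingGeodesic (n : ℕ) {M : Type*} [TopologicalSpace M]
    [ChartedSpace (EuclideanSpace ℝ (Fin n)) M]
    [Bundle.RiemannianBundle (fun x : M ↦ TangentSpace (𝓡 n) x)] (γ : ℝ → M) (x y : M) :
    Prop where
  isGeodesic : IsGeodesic n γ
  source : γ 0 = x
  target : γ 1 = y
  minimizing : ∀ σ : ℝ → M, ContMDiffOn 𝓘(ℝ, ℝ) (𝓡 n) 1 σ (Set.Icc 0 1) → σ 0 = x → σ 1 = y →
    Manifold.pathELength (𝓡 n) γ 0 1 ≤ Manifold.pathELength (𝓡 n) σ 0 1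

/-- The set `G_p^x ⊆ T_p M` of the initial velocities of the length minimizing geodesics from `p`
to `x`. -/
def initialVelocities (n : ℕ) {M : Type*} [TopologicalSpace M]
    [ChartedSpace (EuclideanSpace ℝ (Fin n)) M]
    [Bundle.RiemannianBundle (fun x : M ↦ TangentSpace (𝓡 n) x)] (p x : M) :
    Set (TangentSpace (𝓡 n) p) :=
  {v | ∃ γ : ℝ → M, IsMinimizingGeodesic n γ p x ∧ velocity n γ 0 = ⟨p, v⟩}

/-- A direction function at `p`: a choice `η_p(x) ∈ G_p^x` for every `x`. -/
structure DirectionFunction (n : ℕ) {M : Type*} [TopologicalSpace M]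
    [ChartedSpace (EuclideanSpace ℝ (Fin n)) M]
    [Bundle.RiemannianBundle (fun x : M ↦ TangentSpace (𝓡 n) x)] (p : M) where
  toFun : M → TangentSpace (𝓡 n) p
  mem : ∀ x, toFun x ∈ initialVelocities n p x

/-- The length minimizing geodesic from `p` to `x` with initial velocity `η_p(x)`. -/
def DirectionFunction.geodesic {p : M} (η : DirectionFunction n p) (x : M) : ℝ → M :=
  (η.mem x).choose

theorem DirectionFunction.geodesic_spec {p : M} (η : DirectionFunction n p) (x : M) :
    IsMinimizingGeodesic n (η.geodesic x) p x ∧ velocity n (η.geodesic x) 0 = ⟨p, η.toFun x⟩ :=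
  (η.mem x).choose_spec

/-- The `r`-radial contraction of `x` based at `p` with respect to the direction function `η`. -/
def radialContraction {p : M} (η : DirectionFunction n p) (r : ℝ) (x : M) : M :=
  η.geodesic x r

end Geodesics

end RadialContraction

end

noncomputable section

namespace RadialContraction

open Set Filter MeasureTheory Manifold
open scoped Topology ENNReal

/-! ### The metric and the Christoffel symbols in a chart. -/

section Metric

variable {n : ℕ} {M : Type*} [TopologicalSpace M] [ChartedSpace (EuclideanSpace ℝ (Fin n)) M]

/-! Let `γ` be the geodesic chosen for `x`, let `L` be the distance from `p` to `x`, and let `τ` be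
the geodesic chosen for `γ b`. The choices are unrelated, but for `b < 1` a corner between `τ` and
the rest of `γ` could be cut, which would shorten the way from `p`. Hence `τ` must be the initial
piece of `γ`.

Quantitatively: geodesics have constant speed (`IsGeodesic.norm_velocity`), so distance from `p`
grows linearly along minimizing ones (`IsMinimizingGeodesic.dist_source`). Thus `τ (1 - ε)` and `γ
(b + b * ε)` are at least `2 * ε * b * L` apart. A straight segment in a chart bounds this distance,
to first order, by `ε` times the length of `b γ'(b) + τ'(1)` (`sq_le_chartNormSq_sub`). Both
summands have length `b * L`, so the parallelogram law forces them to be equal. Uniqueness for the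
geodesic equation (`IsPhaseCurve.eqOn`), applied backwards in time from `γ b`, then identifies the
curves.

For `b = 1` there is no continuation past `x` with which to exclude a corner, but then both sides
use the same chosen geodesic. -/

theorem linearMap_apply_eq_sum_single {G : Type*} [AddCommGroup G] [Module ℝ G]
    (L : EuclideanSpace ℝ (Fin n) →ₗ[ℝ] G) (v : EuclideanSpace ℝ (Fin n)) :
    L v = ∑ i, v i • L (EuclideanSpace.single i (1 : ℝ)) := by
  have hv : v = ∑ i, v i • EuclideanSpace.single i (1 : ℝ) := by
    simpa using ((EuclideanSpace.basisFun (Fin n) ℝ).sum_repr v).symm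
  conv_lhs => rw [hv]
  simp only [map_sum, map_smul]

theorem mfderiv_symm_apply_eq_sum (c : M) (y v : EuclideanSpace ℝ (Fin n)) :
    (mfderiv (𝓡 n) (𝓡 n) (extChartAt (𝓡 n) c).symm y v :
      TangentSpace (𝓡 n) ((extChartAt (𝓡 n) c).symm y)) = ∑ i, v i • coordVector c i y :=
  linearMap_apply_eq_sum_single
    (G := TangentSpace (𝓡 n) ((extChartAt (𝓡 n) c).symm y))
    (mfderiv (𝓡 n) (𝓡 n) (extChartAt (𝓡 n) c).symm y).toLinearMap v

theorem isInvertible_mfderiv_extChartAt_symm [IsManifold (𝓡 n) ∞ M] {c : M} {y : EuclideanSpace ℝ (Fin n)}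
    (hy : y ∈ (extChartAt (𝓡 n) c).target) :
    (mfderiv (𝓡 n) (𝓡 n) (extChartAt (𝓡 n) c).symm y).IsInvertible := by
  have : IsManifold (𝓡 n) 1 M := IsManifold.of_le (n := ∞) (by norm_cast)
  have h := isInvertible_mfderivWithin_extChartAt_symm (I := 𝓡 n) hy
  rwa [ModelWithCorners.range_eq_univ, mfderivWithin_univ] at h

theorem contMDiffOn_coordVector [IsManifold (𝓡 n) ∞ M] (c : M) (i : Fin n) :
    ContMDiffOn (𝓡 n) (𝓡 n).tangent ∞
      (fun y ↦ (⟨(extChartAt (𝓡 n) c).symm y, coordVector c i y⟩ : TangentBundle (𝓡 n) M))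
      (extChartAt (𝓡 n) c).target := by
  have : IsManifold (𝓡 n) 1 M := IsManifold.of_le (n := ∞) (by norm_cast)
  have ho : IsOpen (extChartAt (𝓡 n) c).target := isOpen_extChartAt_target c
  have h := ((contMDiffOn_extChartAt_symm (I := 𝓡 n) (n := ∞) c).contMDiffOn_tangentMapWithin
    (m := ∞) (by norm_cast) ho.uniqueMDiffOn)
  have h2 : ContMDiff (𝓡 n) (𝓡 n).tangent ∞ (fun y : EuclideanSpace ℝ (Fin n) ↦
      (⟨y, EuclideanSpace.single i (1 : ℝ)⟩ : TangentBundle (𝓡 n) (EuclideanSpace ℝ (Fin n)))) := by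
    intro y
    refine (Bundle.contMDiffAt_section (F := EuclideanSpace ℝ (Fin n))
      (E := TangentSpace (𝓡 n) (M := EuclideanSpace ℝ (Fin n)))
      (s := fun _ ↦ (EuclideanSpace.single i (1 : ℝ) : EuclideanSpace ℝ (Fin n))) y).2 ?_
    simpa using contMDiffAt_const
  refine (h.comp h2.contMDiffOn fun y hy ↦ hy).congr fun y hy ↦ ?_
  simp only [Function.comp, tangentMapWithin, mfderivWithin_of_isOpen ho hy]
  rfl

variable [Bundle.RiemannianBundle (fun x : M ↦ TangentSpace (𝓡 n) x)]

/-- The squared length `∑ g_ij vⁱ vʲ` of a vector given by its coordinates. -/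
def chartNormSq (c : M) (y v : EuclideanSpace ℝ (Fin n)) : ℝ :=
  ∑ i, ∑ j, metricMatrix c y i j * v i * v j

theorem metricMatrix_apply (c : M) (y : EuclideanSpace ℝ (Fin n)) (i j : Fin n) :
    metricMatrix c y i j = inner ℝ (coordVector c i y) (coordVector c j y) := rfl

theorem metricMatrix_symm (c : M) (y : EuclideanSpace ℝ (Fin n)) (i j : Fin n) :
    metricMatrix c y i j = metricMatrix c y j i := by
  simp only [metricMatrix_apply]
  exact real_inner_comm _ _

theorem norm_mfderiv_symm_sq (c : M) (y v : EuclideanSpace ℝ (Fin n)) :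
    ‖(mfderiv (𝓡 n) (𝓡 n) (extChartAt (𝓡 n) c).symm y v :
      TangentSpace (𝓡 n) ((extChartAt (𝓡 n) c).symm y))‖ ^ 2 = chartNormSq c y v := by
  rw [mfderiv_symm_apply_eq_sum, ← real_inner_self_eq_norm_sq, sum_inner, chartNormSq]
  refine Finset.sum_congr rfl fun i _ ↦ ?_
  rw [inner_sum]
  refine Finset.sum_congr rfl fun j _ ↦ ?_
  rw [real_inner_smul_left, real_inner_smul_right, metricMatrix_apply]
  ring

theorem chartNormSq_nonneg (c : M) (y v : EuclideanSpace ℝ (Fin n)) : 0 ≤ chartNormSq c y v := by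
  rw [← norm_mfderiv_symm_sq]
  positivity

theorem chartNormSq_smul (c : M) (y v : EuclideanSpace ℝ (Fin n)) (r : ℝ) :
    chartNormSq c y (r • v) = r ^ 2 * chartNormSq c y v := by
  simp only [chartNormSq, Finset.mul_sum, PiLp.smul_apply, smul_eq_mul]
  exact Finset.sum_congr rfl fun i _ ↦ Finset.sum_congr rfl fun j _ ↦ by ring

theorem chartNormSq_parallelogram (c : M) (y v w : EuclideanSpace ℝ (Fin n)) :
    chartNormSq c y (v + w) + chartNormSq c y (v - w)
      = 2 * chartNormSq c y v + 2 * chartNormSq c y w := by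
  simp only [chartNormSq, Finset.mul_sum, PiLp.add_apply, PiLp.sub_apply,
    ← Finset.sum_add_distrib]
  exact Finset.sum_congr rfl fun i _ ↦ Finset.sum_congr rfl fun j _ ↦ by ring

variable [IsManifold (𝓡 n) ∞ M]

theorem eq_zero_of_chartNormSq_eq_zero {c : M} {y v : EuclideanSpace ℝ (Fin n)}
    (hy : y ∈ (extChartAt (𝓡 n) c).target) (h : chartNormSq c y v = 0) : v = 0 := by
  rw [← norm_mfderiv_symm_sq, sq_eq_zero_iff, norm_eq_zero] at h
  exact (isInvertible_mfderiv_extChartAt_symm hy).injective (h.trans (map_zero _).symm)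

/-- A kernel vector of the Gram matrix would be a nonzero vector of length zero. -/
theorem det_metricMatrix_ne_zero {c : M} {y : EuclideanSpace ℝ (Fin n)}
    (hy : y ∈ (extChartAt (𝓡 n) c).target) : (metricMatrix c y).det ≠ 0 := by
  intro h
  obtain ⟨v, hv, hv'⟩ := Matrix.exists_mulVec_eq_zero_iff.2 h
  refine hv ?_
  have h0 : chartNormSq c y (WithLp.toLp 2 v) = 0 := by
    have : chartNormSq c y (WithLp.toLp 2 v) = v ⬝ᵥ (metricMatrix c y).mulVec v := by
      simp only [chartNormSq, dotProduct, Matrix.mulVec, Finset.mul_sum]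
      exact Finset.sum_congr rfl fun i _ ↦ Finset.sum_congr rfl fun j _ ↦ by ring
    rw [this, hv', dotProduct_zero]
  have := eq_zero_of_chartNormSq_eq_zero hy h0
  simpa using congrArg (WithLp.ofLp) this

/-- Lowering the upper index cancels the inverse matrix; this is the form needed for conservation of
speed. -/
theorem sum_metricMatrix_mul_christoffel {c : M} {y : EuclideanSpace ℝ (Fin n)}
    (hy : y ∈ (extChartAt (𝓡 n) c).target) (m i j : Fin n) :
    ∑ k, metricMatrix c y m k * christoffel c k i j y
      = (1 / 2 : ℝ) * (partialDeriv i (fun z ↦ metricMatrix c z j m) y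
        + partialDeriv j (fun z ↦ metricMatrix c z i m) y
        - partialDeriv m (fun z ↦ metricMatrix c z i j) y) := by
  set D : Fin n → ℝ := fun l ↦ partialDeriv i (fun z ↦ metricMatrix c z j l) y
        + partialDeriv j (fun z ↦ metricMatrix c z i l) y
        - partialDeriv l (fun z ↦ metricMatrix c z i j) y with hD
  have h1 : ∀ k, christoffel c k i j y = (1 / 2 : ℝ) * ((metricMatrix c y)⁻¹.mulVec D) k :=
    fun k ↦ rfl
  have h2 : (metricMatrix c y).mulVec ((metricMatrix c y)⁻¹.mulVec D) = D := by
    rw [Matrix.mulVec_mulVec, Matrix.mul_nonsing_inv _ (det_metricMatrix_ne_zero hy).isUnit,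
      Matrix.one_mulVec]
  have h3 := congrFun h2 m
  simp only [h1]
  rw [show (1 / 2 : ℝ) * _ = 1 / 2 * D m from rfl, ← h3, Matrix.mulVec, dotProduct, Finset.mul_sum]
  exact Finset.sum_congr rfl fun k _ ↦ by ring

variable [IsContMDiffRiemannianBundle (𝓡 n) ∞ (EuclideanSpace ℝ (Fin n))
      (fun x : M ↦ TangentSpace (𝓡 n) x)]

theorem contDiffOn_metricMatrix (c : M) (i j : Fin n) :
    ContDiffOn ℝ ∞ (fun y ↦ metricMatrix c y i j) (extChartAt (𝓡 n) c).target := by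
  rw [← contMDiffOn_iff_contDiffOn]
  exact (contMDiffOn_coordVector c i).inner_bundle (contMDiffOn_coordVector c j)

theorem contDiffOn_partialDeriv {s : Set (EuclideanSpace ℝ (Fin n))} (hs : IsOpen s)
    {f : EuclideanSpace ℝ (Fin n) → ℝ} (hf : ContDiffOn ℝ ∞ f s) (i : Fin n) :
    ContDiffOn ℝ ∞ (partialDeriv i f) s :=
  (hf.fderiv_of_isOpen hs (by norm_cast)).clm_apply contDiffOn_const

theorem contDiffOn_det {V : Type*} [NormedAddCommGroup V] [NormedSpace ℝ V] {s : Set V} {m : ℕ}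
    {A : V → Matrix (Fin m) (Fin m) ℝ} (hA : ∀ i j, ContDiffOn ℝ ∞ (fun y ↦ A y i j) s) :
    ContDiffOn ℝ ∞ (fun y ↦ (A y).det) s := by
  simp only [Matrix.det_apply']
  exact ContDiffOn.sum fun σ _ ↦ contDiffOn_const.mul (contDiffOn_prod fun i _ ↦ hA _ _)

/-- Cramer's rule: each entry is a quotient of determinants. -/
theorem contDiffOn_matrix_inv {V : Type*} [NormedAddCommGroup V] [NormedSpace ℝ V] {s : Set V}
    {m : ℕ} {A : V → Matrix (Fin m) (Fin m) ℝ}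
    (hA : ∀ i j, ContDiffOn ℝ ∞ (fun y ↦ A y i j) s) (hdet : ∀ y ∈ s, (A y).det ≠ 0)
    (i j : Fin m) : ContDiffOn ℝ ∞ (fun y ↦ (A y)⁻¹ i j) s := by
  simp only [Matrix.inv_def, Ring.inverse_eq_inv', Matrix.smul_apply, smul_eq_mul,
    Matrix.adjugate_apply]
  refine ((contDiffOn_det hA).inv hdet).mul (contDiffOn_det fun k l ↦ ?_)
  by_cases hk : k = j
  · subst hk
    simpa using contDiffOn_const
  · simpa [Matrix.updateRow_apply, hk] using hA k l

theorem contDiffOn_christoffel (c : M) (k i j : Fin n) :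
    ContDiffOn ℝ ∞ (christoffel c k i j) (extChartAt (𝓡 n) c).target := by
  have ho : IsOpen (extChartAt (𝓡 n) c).target := isOpen_extChartAt_target c
  refine contDiffOn_const.mul (ContDiffOn.sum fun l _ ↦ ?_)
  refine (contDiffOn_matrix_inv (contDiffOn_metricMatrix c)
    (fun y hy ↦ det_metricMatrix_ne_zero hy) k l).mul ?_
  exact ((contDiffOn_partialDeriv ho (contDiffOn_metricMatrix c j l) i).add
    (contDiffOn_partialDeriv ho (contDiffOn_metricMatrix c i l) j)).sub
    (contDiffOn_partialDeriv ho (contDiffOn_metricMatrix c i j) l)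

end Metric

/-! ### The geodesic equation as a first-order system, and uniqueness. -/

section PhaseCurves

variable {n : ℕ} {M : Type*} [TopologicalSpace M] [ChartedSpace (EuclideanSpace ℝ (Fin n)) M]
  [Bundle.RiemannianBundle (fun x : M ↦ TangentSpace (𝓡 n) x)]

/-- The quadratic term `∑ Γᵏ_ij vⁱ vʲ` of the geodesic equation. -/
def christoffelTerm (c : M) (y v : EuclideanSpace ℝ (Fin n)) : EuclideanSpace ℝ (Fin n) :=
  WithLp.toLp 2 fun k ↦ ∑ i, ∑ j, christoffel c k i j y * v i * v j

theorem christoffelTerm_smul (c : M) (y v : EuclideanSpace ℝ (Fin n)) (r : ℝ) :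
    christoffelTerm c y (r • v) = r ^ 2 • christoffelTerm c y v := by
  ext k
  simp only [christoffelTerm, PiLp.smul_apply, smul_eq_mul, Finset.mul_sum]
  exact Finset.sum_congr rfl fun i _ ↦ Finset.sum_congr rfl fun j _ ↦ by ring

/-- `σ` is a curve on `[0,1]` with velocity `V c` in the chart around `c`, which satisfies the
geodesic equation, written as a system of first order. -/
structure IsPhaseCurve (σ : ℝ → M) (V : M → ℝ → EuclideanSpace ℝ (Fin n)) : Prop where
  continuousOn : ContinuousOn σ (Icc 0 1)
  position : ∀ c, ∀ t ∈ Icc (0 : ℝ) 1, σ t ∈ (extChartAt (𝓡 n) c).source →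
    HasDerivWithinAt (coordCurve c σ) (V c t) (Icc 0 1) t
  velocity : ∀ c, ∀ t ∈ Icc (0 : ℝ) 1, σ t ∈ (extChartAt (𝓡 n) c).source →
    HasDerivWithinAt (V c) (-christoffelTerm c (coordCurve c σ t) (V c t)) (Icc 0 1) t

/-- The acceleration and the quadratic Christoffel term both scale by `α ^ 2`. Negative `α` is
allowed, which gives time reversal. -/
theorem IsPhaseCurve.comp_affine {σ : ℝ → M} {V : M → ℝ → EuclideanSpace ℝ (Fin n)}
    (h : IsPhaseCurve σ V) {α β : ℝ} (hm : MapsTo (fun t ↦ α * t + β) (Icc 0 1) (Icc 0 1)) :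
    IsPhaseCurve (fun t ↦ σ (α * t + β)) (fun c t ↦ α • V c (α * t + β)) := by
  have hd : ∀ t, HasDerivWithinAt (fun t : ℝ ↦ α * t + β) α (Icc 0 1) t := fun t ↦ by
    simpa using (((hasDerivAt_id t).const_mul α).add_const β).hasDerivWithinAt
  refine ⟨h.continuousOn.comp (by fun_prop) hm, fun c t ht hs ↦ ?_, fun c t ht hs ↦ ?_⟩
  · exact (h.position c _ (hm ht) hs).scomp t (hd t) hm
  · have := ((h.velocity c _ (hm ht) hs).scomp t (hd t) hm).const_smul α
    refine this.congr_deriv ?_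
    rw [christoffelTerm_smul, smul_smul, smul_neg, sq]
    rfl

theorem IsPhaseCurve.eventually_mem_source {σ : ℝ → M} {V : M → ℝ → EuclideanSpace ℝ (Fin n)}
    (h : IsPhaseCurve σ V) {c : M} {t : ℝ} (ht : t ∈ Icc (0 : ℝ) 1)
    (hs : σ t ∈ (extChartAt (𝓡 n) c).source) :
    ∀ᶠ s in 𝓝[Icc 0 1] t, σ s ∈ (extChartAt (𝓡 n) c).source := by
  have ho : IsOpen (extChartAt (𝓡 n) c).source := isOpen_extChartAt_source c
  exact h.continuousOn t ht (ho.mem_nhds hs)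

variable [IsManifold (𝓡 n) ∞ M]

theorem IsGeodesic.isPhaseCurve {γ : ℝ → M} (h : IsGeodesic n γ) :
    IsPhaseCurve γ (fun c ↦ derivWithin (coordCurve (n := n) c γ) (Icc 0 1)) := by
  have hsm : ∀ c, ∀ t ∈ Icc (0 : ℝ) 1, γ t ∈ (extChartAt (𝓡 n) c).source →
      ContDiffWithinAt ℝ ∞ (coordCurve c γ) (Icc 0 1) t := fun c t ht hs ↦ by
    rw [← contMDiffWithinAt_iff_contDiffWithinAt]
    rw [extChartAt_source] at hs
    exact (contMDiffAt_extChartAt' hs).comp_contMDiffWithinAt t (h.smooth t ht)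
  have hu : UniqueDiffOn ℝ (Icc (0 : ℝ) 1) := uniqueDiffOn_Icc zero_lt_one
  refine ⟨h.smooth.continuousOn, fun c t ht hs ↦ ?_, fun c t ht hs ↦ ?_⟩
  · exact ((hsm c t ht hs).differentiableWithinAt (by simp)).hasDerivWithinAt
  · have h1 : ContDiffWithinAt ℝ 1 (derivWithin (coordCurve c γ) (Icc 0 1)) (Icc 0 1) t :=
      (hsm c t ht hs).derivWithin hu (by norm_cast) ht
    have h2 := (h1.differentiableWithinAt (by simp)).hasDerivWithinAt
    refine h2.congr_deriv ?_
    ext k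
    have := h.equation c t ht hs k
    simp only [christoffelTerm, PiLp.neg_apply]
    linarith

variable [IsContMDiffRiemannianBundle (𝓡 n) ∞ (EuclideanSpace ℝ (Fin n))
      (fun x : M ↦ TangentSpace (𝓡 n) x)]

theorem contDiffAt_geodesicField {c : M} {y : EuclideanSpace ℝ (Fin n)}
    (hy : y ∈ (extChartAt (𝓡 n) c).target) (v : EuclideanSpace ℝ (Fin n)) :
    ContDiffAt ℝ 1 (fun z : EuclideanSpace ℝ (Fin n) × EuclideanSpace ℝ (Fin n) ↦
      (z.2, -christoffelTerm c z.1 z.2)) (y, v) := by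
  have hc : ∀ i, ContDiffAt ℝ 1
      (fun z : EuclideanSpace ℝ (Fin n) × EuclideanSpace ℝ (Fin n) ↦ z.2 i) (y, v) := fun i ↦
    contDiffAt_euclidean.1 contDiffAt_snd i
  have hk : ∀ k, ContDiffAt ℝ 1
      (fun z : EuclideanSpace ℝ (Fin n) × EuclideanSpace ℝ (Fin n) ↦
        ∑ i, ∑ j, christoffel c k i j z.1 * z.2 i * z.2 j) (y, v) := by
    refine fun k ↦ ContDiffAt.sum fun i _ ↦ ContDiffAt.sum fun j _ ↦ ?_
    have h1 : ContDiffAt ℝ 1 (christoffel c k i j) y :=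
      ((contDiffOn_christoffel c k i j).contDiffAt
        ((isOpen_extChartAt_target c).mem_nhds hy)).of_le (by norm_cast)
    exact ((h1.comp (y, v) contDiffAt_fst).mul (hc i)).mul (hc j)
  have hG : ContDiffAt ℝ 1
      (fun z : EuclideanSpace ℝ (Fin n) × EuclideanSpace ℝ (Fin n) ↦
        christoffelTerm c z.1 z.2) (y, v) := contDiffAt_euclidean.2 hk
  exact contDiffAt_snd.prodMk hG.neg

/-- Just after `t` both curves stay in the chart at `σ t`, where position and velocity solve one
autonomous system with a locally Lipschitz field. -/
theorem IsPhaseCurve.eventuallyEq {σ τ : ℝ → M} {V W : M → ℝ → EuclideanSpace ℝ (Fin n)}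
    (hσ : IsPhaseCurve σ V) (hτ : IsPhaseCurve τ W) {t : ℝ} (ht : t ∈ Ico (0 : ℝ) 1)
    (h0 : σ t = τ t) (h1 : V (σ t) t = W (σ t) t) : ∀ᶠ s in 𝓝[>] t, EqOn σ τ (Icc t s) := by
  set c := σ t with hc
  have ht' : t ∈ Icc (0 : ℝ) 1 := Ico_subset_Icc_self ht
  have hcs : c ∈ (extChartAt (𝓡 n) c).source := mem_extChartAt_source c
  have hcτ : τ t ∈ (extChartAt (𝓡 n) c).source := h0 ▸ hcs
  obtain ⟨K, S, hS, hK⟩ := (contDiffAt_geodesicField (mem_extChartAt_target (I := 𝓡 n) c)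
    (V c t)).exists_lipschitzOnWith
  -- The bound `s < 1` leaves room to the right of `s`, so that derivatives within `[0,1]` yield
  -- right derivatives.
  have key : ∀ {ρ : ℝ → M} {U : M → ℝ → EuclideanSpace ℝ (Fin n)}, IsPhaseCurve ρ U →
      ρ t = c → U c t = V c t → ∀ᶠ s in 𝓝[≥] t, ρ s ∈ (extChartAt (𝓡 n) c).source ∧
        (coordCurve c ρ s, U c s) ∈ S ∧ s < 1 := by
    intro ρ U hρ e0 e1
    have hsrc : ρ t ∈ (extChartAt (𝓡 n) c).source := e0 ▸ hcs
    have hcont : ContinuousWithinAt (fun s ↦ (coordCurve c ρ s, U c s)) (Icc 0 1) t :=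
      (hρ.position c t ht' hsrc).continuousWithinAt.prodMk
        (hρ.velocity c t ht' hsrc).continuousWithinAt
    have hS' : S ∈ 𝓝 (coordCurve c ρ t, U c t) := by
      rw [e1, coordCurve, e0]
      exact hS
    have hle : 𝓝[≥] t ≤ 𝓝[Icc 0 1] t := by
      rw [← nhdsWithin_Icc_eq_nhdsGE ht.2]
      exact nhdsWithin_mono _ (Icc_subset_Icc_left ht.1)
    filter_upwards [hle (hρ.eventually_mem_source ht' hsrc), hle (hcont hS'),
      mem_nhdsWithin_of_mem_nhds (Iio_mem_nhds ht.2)] with s h1 h2 h3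
    exact ⟨h1, h2, h3⟩
  have hev := (key hσ rfl rfl).and (key hτ h0.symm h1.symm)
  obtain ⟨u, hu, hut⟩ := (mem_nhdsGE_iff_exists_Icc_subset).1 hev
  filter_upwards [Ioc_mem_nhdsGT hu] with s hs
  have hsub : ∀ r ∈ Icc t s, _ := fun r hr ↦ hut ⟨hr.1, hr.2.trans hs.2⟩
  have der : ∀ {ρ : ℝ → M} {U : M → ℝ → EuclideanSpace ℝ (Fin n)}, IsPhaseCurve ρ U →
      ∀ r, t ≤ r → r < 1 → ρ r ∈ (extChartAt (𝓡 n) c).source →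
      HasDerivWithinAt (fun s ↦ (coordCurve c ρ s, U c s))
        (U c r, -christoffelTerm c (coordCurve c ρ r) (U c r)) (Ici r) r := by
    intro ρ U hρ r hr hr1 hsrc
    have hr' : r ∈ Icc (0 : ℝ) 1 := ⟨ht.1.trans hr, hr1.le⟩
    refine ((hρ.position c r hr' hsrc).prodMk (hρ.velocity c r hr' hsrc)).mono_of_mem_nhdsWithin ?_
    exact mem_of_superset (Icc_mem_nhdsGE hr1) (Icc_subset_Icc_left hr'.1)
  have := ODE_solution_unique_of_mem_Icc_right (a := t) (b := s) (K := K) (s := fun _ ↦ S)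
    (v := fun _ z ↦ (z.2, -christoffelTerm c z.1 z.2))
    (f := fun s ↦ (coordCurve c σ s, V c s)) (g := fun s ↦ (coordCurve c τ s, W c s))
    (fun _ _ ↦ hK) ?_ ?_ ?_ ?_ ?_ ?_ ?_
  · intro r hr
    have hr' := hsub r hr
    have e := congrArg Prod.fst (this hr)
    exact (extChartAt (𝓡 n) c).injOn hr'.1.1 hr'.2.1 e
  · intro r hr
    have hr' := hsub r hr
    have hI : r ∈ Icc (0 : ℝ) 1 := ⟨ht.1.trans hr.1, hr'.1.2.2.le⟩
    exact ((hσ.position c r hI hr'.1.1).continuousWithinAt.prodMk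
        (hσ.velocity c r hI hr'.1.1).continuousWithinAt).mono
        (Icc_subset_Icc ht.1 (hsub s ⟨hs.1.le, le_rfl⟩).1.2.2.le)
  · intro r hr
    have hr' := hsub r ⟨hr.1, hr.2.le⟩
    exact der hσ r hr.1 hr'.1.2.2 hr'.1.1
  · exact fun r hr ↦ (hsub r ⟨hr.1, hr.2.le⟩).1.2.1
  · intro r hr
    have hr' := hsub r hr
    have hI : r ∈ Icc (0 : ℝ) 1 := ⟨ht.1.trans hr.1, hr'.1.2.2.le⟩
    exact ((hτ.position c r hI hr'.2.1).continuousWithinAt.prodMk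
        (hτ.velocity c r hI hr'.2.1).continuousWithinAt).mono
        (Icc_subset_Icc ht.1 (hsub s ⟨hs.1.le, le_rfl⟩).1.2.2.le)
  · intro r hr
    have hr' := hsub r ⟨hr.1, hr.2.le⟩
    exact der hτ r hr.1 hr'.1.2.2 hr'.2.1
  · exact fun r hr ↦ (hsub r ⟨hr.1, hr.2.le⟩).2.2.1
  · simp only [coordCurve, ← h0, ← hc, h1]

/-- Two solutions of the geodesic equation with the same initial position and velocity agree. -/
theorem IsPhaseCurve.eqOn [T2Space M] {σ τ : ℝ → M} {V W : M → ℝ → EuclideanSpace ℝ (Fin n)}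
    (hσ : IsPhaseCurve σ V) (hτ : IsPhaseCurve τ W) (h0 : σ 0 = τ 0)
    (h1 : V (σ 0) 0 = W (σ 0) 0) : EqOn σ τ (Icc 0 1) := by
  set S : Set ℝ := {s | EqOn σ τ (Icc 0 s)} with hS
  suffices Icc (0 : ℝ) 1 ⊆ S from fun t ht ↦ this ht ⟨ht.1, le_rfl⟩
  -- Continuous induction: the times up to which the curves agree form a closed set that can be
  -- extended to the right.
  refine IsClosed.Icc_subset_of_forall_mem_nhdsWithin ?_ ?_ ?_
  · have hA : IsClosed (Icc (0 : ℝ) 1 ∩ (fun t ↦ (σ t, τ t)) ⁻¹' diagonal M) :=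
      (hσ.continuousOn.prodMk hτ.continuousOn).preimage_isClosed_of_isClosed isClosed_Icc
        isClosed_diagonal
    have hsub : S ∩ Icc 0 1 ⊆ Icc (0 : ℝ) 1 ∩ (fun t ↦ (σ t, τ t)) ⁻¹' diagonal M :=
      fun t ht ↦ ⟨ht.2, ht.1 ⟨ht.2.1, le_rfl⟩⟩
    refine isClosed_of_closure_subset fun t ht ↦ ?_
    have htA := closure_minimal hsub hA ht
    refine ⟨fun r hr ↦ ?_, htA.1⟩
    rcases hr.2.eq_or_lt with rfl | hlt
    · exact htA.2
    · obtain ⟨s, hs, hsS⟩ := mem_closure_iff.1 ht (Ioi r) isOpen_Ioi hlt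
      exact hsS.1 ⟨hr.1, le_of_lt hs⟩
  · intro r hr
    rw [show r = 0 from le_antisymm hr.2 hr.1]
    exact h0
  · rintro t ⟨htS, ht⟩
    have e0 : σ t = τ t := htS ⟨ht.1, le_rfl⟩
    -- For `t > 0` both velocities are left derivatives of the same coordinate curve.
    have e1 : V (σ t) t = W (σ t) t := by
      rcases ht.1.eq_or_lt with rfl | hpos
      · exact h1
      have ht' : t ∈ Icc (0 : ℝ) 1 := Ico_subset_Icc_self ht
      have d1 := (hσ.position (σ t) t ht' (mem_extChartAt_source _)).mono
        (Icc_subset_Icc_right ht.2.le : Icc 0 t ⊆ Icc 0 1)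
      have d2 := (hτ.position (σ t) t ht' (e0 ▸ mem_extChartAt_source _)).mono
        (Icc_subset_Icc_right ht.2.le : Icc 0 t ⊆ Icc 0 1)
      refine (uniqueDiffOn_Icc hpos t ⟨hpos.le, le_rfl⟩).eq_deriv _ d1 (d2.congr ?_ ?_)
      · exact fun s hs ↦ congrArg _ (htS hs)
      · exact congrArg _ e0
    filter_upwards [hσ.eventuallyEq hτ ht e0 e1] with s hs r hr
    rcases le_total r t with h | h
    · exact htS ⟨hr.1, h⟩
    · exact hs ⟨h, hr.2⟩

end PhaseCurves

/-! ### Conservation of speed along geodesics. -/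

section Speed

variable {n : ℕ} {M : Type*} [TopologicalSpace M] [ChartedSpace (EuclideanSpace ℝ (Fin n)) M]
  [Bundle.RiemannianBundle (fun x : M ↦ TangentSpace (𝓡 n) x)]

theorem fderiv_apply_eq_sum_partialDeriv (f : EuclideanSpace ℝ (Fin n) → ℝ)
    (y v : EuclideanSpace ℝ (Fin n)) : fderiv ℝ f y v = ∑ l, v l * partialDeriv l f y :=
  linearMap_apply_eq_sum_single (fderiv ℝ f y).toLinearMap v

theorem sum_rotate {m : ℕ} (f : Fin m → Fin m → Fin m → ℝ) :
    ∑ k, ∑ i, ∑ j, f i j k = ∑ i, ∑ j, ∑ k, f i j k := by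
  rw [Finset.sum_comm]
  exact Finset.sum_congr rfl fun i _ ↦ Finset.sum_comm

/-- After contraction with three copies of `v`, the three terms become the same sum, with signs `+`,
`+`, `-`. -/
theorem sum_christoffel_symmetrization {m : ℕ} (P : Fin m → Fin m → Fin m → ℝ) (v : Fin m → ℝ) :
    ∑ k, v k * ∑ i, ∑ j, (P i j k + P j i k - P k i j) * v i * v j
      = ∑ i, ∑ j, (∑ l, v l * P l i j) * v i * v j := by
  set f : Fin m → Fin m → Fin m → ℝ := fun a b c ↦ v a * P a b c * v b * v c with hf
  have e1 := sum_rotate f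
  have e2 : ∑ k, ∑ i, ∑ j, f j i k = ∑ i, ∑ j, ∑ k, f i j k :=
    (sum_rotate fun a b c ↦ f b a c).trans Finset.sum_comm
  have e3 := sum_rotate fun a b c ↦ f c a b
  calc _ = ∑ k, ∑ i, ∑ j, f i j k + ∑ k, ∑ i, ∑ j, f j i k - ∑ k, ∑ i, ∑ j, f k i j := by
        simp only [← Finset.sum_add_distrib, ← Finset.sum_sub_distrib, Finset.mul_sum]
        refine Finset.sum_congr rfl fun k _ ↦ Finset.sum_congr rfl fun i _ ↦
          Finset.sum_congr rfl fun j _ ↦ ?_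
        simp only [hf]
        ring
    _ = ∑ i, ∑ j, ∑ l, f l i j := by rw [e1, e2, ← e3]; ring
    _ = _ := by
        simp only [Finset.sum_mul]
        rfl

variable [IsManifold (𝓡 n) ∞ M]

theorem norm_mfderivWithin_sq {γ : ℝ → M} {t : ℝ} {c : M}
    (hγ : ContMDiffOn 𝓘(ℝ, ℝ) (𝓡 n) ∞ γ (Icc 0 1)) (ht : t ∈ Icc (0 : ℝ) 1)
    (hs : γ t ∈ (extChartAt (𝓡 n) c).source) :
    ‖(mfderivWithin 𝓘(ℝ, ℝ) (𝓡 n) γ (Icc 0 1) t (1 : ℝ) : TangentSpace (𝓡 n) (γ t))‖ ^ 2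
      = chartNormSq c (coordCurve c γ t) (derivWithin (coordCurve (n := n) c γ) (Icc 0 1) t) := by
  have hu : UniqueDiffWithinAt ℝ (Icc (0 : ℝ) 1) t := uniqueDiffOn_Icc zero_lt_one t ht
  have ho : IsOpen (extChartAt (𝓡 n) c).source := isOpen_extChartAt_source c
  have hev : γ =ᶠ[𝓝[Icc 0 1] t] (extChartAt (𝓡 n) c).symm ∘ coordCurve (n := n) c γ := by
    filter_upwards [hγ.continuousOn t ht (ho.mem_nhds hs)] with s hs
    exact ((extChartAt (𝓡 n) c).left_inv hs).symm
  have htgt : coordCurve c γ t ∈ (extChartAt (𝓡 n) c).target := (extChartAt (𝓡 n) c).map_source hs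
  have h1 : MDifferentiableWithinAt 𝓘(ℝ, ℝ) (𝓡 n) (coordCurve (n := n) c γ) (Icc 0 1) t := by
    rw [extChartAt_source] at hs
    exact ((contMDiffAt_extChartAt' (n := ∞) hs).comp_contMDiffWithinAt t
      (hγ t ht)).mdifferentiableWithinAt (by simp)
  have h2 : MDifferentiableAt (𝓡 n) (𝓡 n) (extChartAt (𝓡 n) c).symm (coordCurve c γ t) :=
    ((contMDiffOn_extChartAt_symm (I := 𝓡 n) (n := ∞) c).contMDiffAt
      ((isOpen_extChartAt_target c).mem_nhds htgt)).mdifferentiableAt (by simp)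
  have h3 := hev.mfderivWithin_eq (I := 𝓘(ℝ, ℝ)) (I' := 𝓡 n) (hev.self_of_nhdsWithin ht)
  have h4 := mfderiv_comp_mfderivWithin t h2 h1 hu.uniqueMDiffWithinAt
  have h5 : mfderivWithin 𝓘(ℝ, ℝ) (𝓡 n) (coordCurve (n := n) c γ) (Icc 0 1) t (1 : ℝ)
      = derivWithin (coordCurve (n := n) c γ) (Icc 0 1) t := by
    rw [mfderivWithin_eq_fderivWithin]
    exact fderivWithin_derivWithin
  -- The base points are only propositionally equal and the norm depends on them, so vectors are
  -- compared in the total space.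
  have h6 : (⟨γ t, mfderivWithin 𝓘(ℝ, ℝ) (𝓡 n) γ (Icc 0 1) t (1 : ℝ)⟩ : TangentBundle (𝓡 n) M)
      = ⟨(extChartAt (𝓡 n) c).symm (coordCurve c γ t),
          mfderiv (𝓡 n) (𝓡 n) (extChartAt (𝓡 n) c).symm (coordCurve c γ t)
          (derivWithin (coordCurve (n := n) c γ) (Icc 0 1) t)⟩ := by
    refine Bundle.TotalSpace.ext ((extChartAt (𝓡 n) c).left_inv hs).symm ?_
    refine @heq_of_eq (EuclideanSpace ℝ (Fin n)) _ _ ?_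
    have h7 := congrArg (fun L : ℝ →L[ℝ] EuclideanSpace ℝ (Fin n) ↦ L 1) (h3.trans h4)
    exact h7.trans (congrArg (fun w : EuclideanSpace ℝ (Fin n) ↦
      (mfderiv (𝓡 n) (𝓡 n) (extChartAt (𝓡 n) c).symm (coordCurve c γ t) w :
        EuclideanSpace ℝ (Fin n))) h5)
  rw [← norm_mfderiv_symm_sq]
  exact congrArg (fun X : TangentBundle (𝓡 n) M ↦ ‖X.2‖ ^ 2) h6

variable [IsContMDiffRiemannianBundle (𝓡 n) ∞ (EuclideanSpace ℝ (Fin n))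
      (fun x : M ↦ TangentSpace (𝓡 n) x)]

/-- Metric compatibility: the derivative is `(∂_v g)(v, v) + 2 g(v, a)`, and the geodesic equation
gives `g(v, a) = -½ (∂_v g)(v, v)`. -/
theorem IsPhaseCurve.hasDerivWithinAt_chartNormSq {σ : ℝ → M}
    {V : M → ℝ → EuclideanSpace ℝ (Fin n)} (h : IsPhaseCurve σ V) {c : M} {t : ℝ}
    (ht : t ∈ Icc (0 : ℝ) 1) (hs : σ t ∈ (extChartAt (𝓡 n) c).source) :
    HasDerivWithinAt (fun s ↦ chartNormSq c (coordCurve c σ s) (V c s)) 0 (Icc 0 1) t := by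
  set y := coordCurve (n := n) c σ t with hy
  have hyt : y ∈ (extChartAt (𝓡 n) c).target := (extChartAt (𝓡 n) c).map_source hs
  set v := V c t with hv
  set a := -christoffelTerm c y v with ha
  have hV : ∀ i, HasDerivWithinAt (fun s ↦ V c s i) (a i) (Icc 0 1) t :=
    fun i ↦ (EuclideanSpace.proj (𝕜 := ℝ) i).hasFDerivAt.comp_hasDerivWithinAt t
      (h.velocity c t ht hs)
  have hG : ∀ i j, HasDerivWithinAt (fun s ↦ metricMatrix c (coordCurve c σ s) i j)
      (∑ l, v l * partialDeriv l (fun z ↦ metricMatrix c z i j) y) (Icc 0 1) t := by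
    intro i j
    rw [← fderiv_apply_eq_sum_partialDeriv]
    have hd : DifferentiableAt ℝ (fun z ↦ metricMatrix c z i j) y :=
      ((contDiffOn_metricMatrix c i j).contDiffAt
        ((isOpen_extChartAt_target c).mem_nhds hyt)).differentiableAt (by simp)
    exact hd.hasFDerivAt.comp_hasDerivWithinAt t (h.position c t ht hs)
  have hsum := HasDerivWithinAt.fun_sum (u := Finset.univ) fun i _ ↦
    HasDerivWithinAt.fun_sum (u := Finset.univ) fun j _ ↦ ((hG i j).mul (hV i)).mul (hV j)
  refine hsum.congr_deriv ?_
  have hga : ∀ i, ∑ j, metricMatrix c y i j * a j = -(1 / 2 : ℝ) * ∑ k, ∑ l,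
      (partialDeriv k (fun z ↦ metricMatrix c z l i) y
        + partialDeriv l (fun z ↦ metricMatrix c z k i) y
        - partialDeriv i (fun z ↦ metricMatrix c z k l) y) * v k * v l := by
    intro i
    have : ∀ k l, (partialDeriv k (fun z ↦ metricMatrix c z l i) y
        + partialDeriv l (fun z ↦ metricMatrix c z k i) y
        - partialDeriv i (fun z ↦ metricMatrix c z k l) y)
        = 2 * ∑ m, metricMatrix c y i m * christoffel c m k l y := fun k l ↦ by
      rw [sum_metricMatrix_mul_christoffel hyt]; ring
    simp only [this, ha, christoffelTerm, PiLp.neg_apply, Finset.mul_sum, Finset.sum_mul]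
    simp only [mul_neg, Finset.mul_sum, Finset.sum_neg_distrib]
    rw [sum_rotate fun k l j ↦ metricMatrix c y i j * (christoffel c j k l y * v k * v l),
      ← Finset.sum_neg_distrib]
    refine Finset.sum_congr rfl fun k _ ↦ ?_
    rw [← Finset.sum_neg_distrib]
    refine Finset.sum_congr rfl fun l _ ↦ ?_
    rw [← Finset.sum_neg_distrib]
    exact Finset.sum_congr rfl fun m _ ↦ by ring
  have hsymm := sum_christoffel_symmetrization
    (fun l i j ↦ partialDeriv l (fun z ↦ metricMatrix c z i j) y) v
  have h1 : ∑ i, v i * ∑ j, metricMatrix c y i j * a j = -(1 / 2 : ℝ) *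
      ∑ i, ∑ j, (∑ l, v l * partialDeriv l (fun z ↦ metricMatrix c z i j) y) * v i * v j := by
    rw [← hsymm, Finset.mul_sum]
    refine Finset.sum_congr rfl fun i _ ↦ ?_
    rw [hga]
    ring
  have h2 : ∑ i, ∑ j, metricMatrix c y i j * a i * v j
      = ∑ i, v i * ∑ j, metricMatrix c y i j * a j := by
    rw [Finset.sum_comm]
    refine Finset.sum_congr rfl fun i _ ↦ ?_
    rw [Finset.mul_sum]
    refine Finset.sum_congr rfl fun j _ ↦ ?_
    rw [metricMatrix_symm c y j i]
    ring
  calc _ = ∑ i, ∑ j, (∑ l, v l * partialDeriv l (fun z ↦ metricMatrix c z i j) y) * v i * v j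
        + ∑ i, ∑ j, metricMatrix c y i j * a i * v j
        + ∑ i, v i * ∑ j, metricMatrix c y i j * a j := by
        simp only [← Finset.sum_add_distrib]
        refine Finset.sum_congr rfl fun i _ ↦ ?_
        rw [Finset.mul_sum, ← Finset.sum_add_distrib]
        refine Finset.sum_congr rfl fun j _ ↦ ?_
        simp only [Pi.mul_apply, ← hv, ← hy]
        ring
    _ = 0 := by rw [h2, h1]; ring

end Speed

/-! ### Lengths and distances along minimizing geodesics. -/

section Distance

variable {n : ℕ} {M : Type*} [MetricSpace M] [ChartedSpace (EuclideanSpace ℝ (Fin n)) M]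
  [Bundle.RiemannianBundle (fun x : M ↦ TangentSpace (𝓡 n) x)]
  [IsManifold (𝓡 n) ∞ M]
  [IsContMDiffRiemannianBundle (𝓡 n) ∞ (EuclideanSpace ℝ (Fin n))
      (fun x : M ↦ TangentSpace (𝓡 n) x)]

theorem IsGeodesic.norm_velocity {γ : ℝ → M} (h : IsGeodesic n γ) {t : ℝ}
    (ht : t ∈ Icc (0 : ℝ) 1) : ‖(velocity n γ t).2‖ = ‖(velocity n γ 0).2‖ := by
  have hd : ∀ t ∈ Icc (0 : ℝ) 1,
      HasDerivWithinAt (fun t ↦ ‖(velocity n γ t).2‖ ^ 2) 0 (Icc 0 1) t := fun t ht ↦ by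
    have hs : γ t ∈ (extChartAt (𝓡 n) (γ t)).source := mem_extChartAt_source _
    refine (h.isPhaseCurve.hasDerivWithinAt_chartNormSq ht hs).congr_of_eventuallyEq ?_
      (norm_mfderivWithin_sq h.smooth ht hs)
    filter_upwards [h.isPhaseCurve.eventually_mem_source ht hs, self_mem_nhdsWithin] with s h1 h2
    exact norm_mfderivWithin_sq h.smooth h2 h1
  have := constant_of_derivWithin_zero (fun t ht ↦ (hd t ht).differentiableWithinAt)
    (fun t ht ↦ (hd t (Ico_subset_Icc_self ht)).derivWithin
      (uniqueDiffOn_Icc zero_lt_one t (Ico_subset_Icc_self ht))) t ht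
  exact (sq_eq_sq₀ (norm_nonneg _) (norm_nonneg _)).1 this

theorem IsGeodesic.pathELength_eq {γ : ℝ → M} (h : IsGeodesic n γ) {a b : ℝ} (ha : 0 ≤ a)
    (hb : b ≤ 1) :
    pathELength (𝓡 n) γ a b = ENNReal.ofReal (b - a) * ‖(velocity n γ 0).2‖ₑ := by
  rw [pathELength_eq_lintegral_mfderiv_Ioo]
  rw [setLIntegral_congr_fun (g := fun _ ↦ ‖(velocity n γ 0).2‖ₑ) measurableSet_Ioo]
  · rw [setLIntegral_const, Real.volume_Ioo, mul_comm]
  · intro t ht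
    have ht' : t ∈ Icc (0 : ℝ) 1 := ⟨ha.trans ht.1.le, ht.2.le.trans hb⟩
    have hn : Icc (0 : ℝ) 1 ∈ 𝓝 t :=
      Icc_mem_nhds (ha.trans_lt ht.1) (ht.2.trans_le hb)
    have h1 : ‖(velocity n γ t).2‖ₑ = ‖(velocity n γ 0).2‖ₑ := by
      rw [← ofReal_norm, ← ofReal_norm, h.norm_velocity ht']
    rw [velocity, mfderivWithin_of_mem_nhds hn] at h1
    exact h1

variable [IsRiemannianManifold (𝓡 n) M]

theorem IsGeodesic.edist_le {γ : ℝ → M} (h : IsGeodesic n γ) {a b : ℝ} (ha : 0 ≤ a) (hab : a ≤ b)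
    (hb : b ≤ 1) : edist (γ a) (γ b) ≤ ENNReal.ofReal (b - a) * ‖(velocity n γ 0).2‖ₑ := by
  rw [IsRiemannianManifold.out (I := 𝓡 n), ← h.pathELength_eq ha hb]
  exact riemannianEDist_le_pathELength
    ((h.smooth.of_le (by norm_cast)).mono (Icc_subset_Icc ha hb)) rfl rfl hab

/-- Constant speed makes the left side the length of `γ`. Being minimal among `C¹` curves on
`[0,1]`, this length is the Riemannian distance. -/
theorem IsMinimizingGeodesic.norm_velocity_zero {γ : ℝ → M} {x y : M}
    (h : IsMinimizingGeodesic n γ x y) : ‖(velocity n γ 0).2‖ = dist x y := by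
  have h1 : pathELength (𝓡 n) γ 0 1 = ‖(velocity n γ 0).2‖ₑ := by
    simpa using h.isGeodesic.pathELength_eq le_rfl le_rfl
  have h2 : edist x y = ‖(velocity n γ 0).2‖ₑ := by
    refine le_antisymm ?_ (le_of_forall_gt fun r hr ↦ ?_)
    · simpa [h.source, h.target] using h.isGeodesic.edist_le le_rfl zero_le_one le_rfl
    · rw [IsRiemannianManifold.out (I := 𝓡 n)] at hr
      obtain ⟨σ, h0, h1', hσ, hlen⟩ := exists_lt_of_riemannianEDist_lt hr
      rw [← h1]
      exact (h.minimizing σ hσ h0 h1').trans_lt hlen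
  rw [dist_edist, h2, toReal_enorm]

theorem IsMinimizingGeodesic.dist_le {γ : ℝ → M} {x y : M} (h : IsMinimizingGeodesic n γ x y)
    {a b : ℝ} (ha : 0 ≤ a) (hab : a ≤ b) (hb : b ≤ 1) :
    dist (γ a) (γ b) ≤ (b - a) * dist x y := by
  have := h.isGeodesic.edist_le ha hab hb
  rw [← ofReal_norm, h.norm_velocity_zero, ← ENNReal.ofReal_mul (by linarith),
    edist_dist] at this
  exact (ENNReal.ofReal_le_ofReal_iff (mul_nonneg (by linarith) dist_nonneg)).1 this

/-- The upper bounds on `[0,t]` and `[t,1]` add up to the total distance, so the triangle inequality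
makes both sharp. -/
theorem IsMinimizingGeodesic.dist_source {γ : ℝ → M} {x y : M} (h : IsMinimizingGeodesic n γ x y)
    {t : ℝ} (ht : t ∈ Icc (0 : ℝ) 1) : dist x (γ t) = t * dist x y := by
  have h1 := h.dist_le le_rfl ht.1 ht.2
  have h2 := h.dist_le ht.1 ht.2 le_rfl
  have h3 := dist_triangle x (γ t) y
  rw [h.source] at h1
  rw [h.target] at h2
  linarith

end Distance

/-! ### Absence of corners, and coincidence of minimizing geodesics. -/

section Corners

variable {n : ℕ} {M : Type*} [MetricSpace M] [ChartedSpace (EuclideanSpace ℝ (Fin n)) M]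
  [Bundle.RiemannianBundle (fun x : M ↦ TangentSpace (𝓡 n) x)]
  [IsManifold (𝓡 n) ∞ M]
  [IsContMDiffRiemannianBundle (𝓡 n) ∞ (EuclideanSpace ℝ (Fin n))
      (fun x : M ↦ TangentSpace (𝓡 n) x)]

theorem continuousAt_chartNormSq {c : M} {y : EuclideanSpace ℝ (Fin n)}
    (hy : y ∈ (extChartAt (𝓡 n) c).target) (v : EuclideanSpace ℝ (Fin n)) :
    ContinuousAt (fun z : EuclideanSpace ℝ (Fin n) × EuclideanSpace ℝ (Fin n) ↦
      chartNormSq c z.1 z.2) (y, v) := by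
  have hG : ∀ i j, ContinuousAt (fun z : EuclideanSpace ℝ (Fin n) × EuclideanSpace ℝ (Fin n) ↦
      metricMatrix c z.1 i j) (y, v) := fun i j ↦ by
    have h : ContinuousAt (fun z ↦ metricMatrix c z i j) y :=
      (contDiffOn_metricMatrix c i j).continuousOn.continuousAt
        ((isOpen_extChartAt_target c).mem_nhds hy)
    exact h.comp (f := Prod.fst) (x := (y, v)) continuousAt_fst
  have hc : ∀ i, ContinuousAt (fun z : EuclideanSpace ℝ (Fin n) × EuclideanSpace ℝ (Fin n) ↦
      z.2 i) (y, v) := fun i ↦ by fun_prop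
  exact tendsto_finsetSum _ fun i _ ↦ tendsto_finsetSum _ fun j _ ↦
    ((hG i j).mul (hc i)).mul (hc j)

variable [IsRiemannianManifold (𝓡 n) M]

/-- The segment between two points close to `y` in a chart bounds their distance, sharply to first
order. -/
theorem exists_edist_extChartAt_symm_le {c : M} {y v : EuclideanSpace ℝ (Fin n)}
    (hy : y ∈ (extChartAt (𝓡 n) c).target) {K : ℝ} (hK : 0 < K) (hv : chartNormSq c y v < K ^ 2) :
    ∃ U ∈ 𝓝 y, ∃ W ∈ 𝓝 v, ∀ a ∈ U, ∀ d ∈ W, ∀ ε > 0, a + ε • d ∈ U →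
      edist ((extChartAt (𝓡 n) c).symm a) ((extChartAt (𝓡 n) c).symm (a + ε • d))
        ≤ ENNReal.ofReal (ε * K) := by
  have hev := (continuousAt_chartNormSq hy v).eventually (gt_mem_nhds hv)
  rw [nhds_prod_eq] at hev
  obtain ⟨U', hU', W, hW, hUW⟩ := eventually_prod_iff.1 hev
  obtain ⟨r, hr, hball⟩ := Metric.mem_nhds_iff.1
    (inter_mem hU' ((isOpen_extChartAt_target (I := 𝓡 n) c).mem_nhds hy))
  -- A ball is convex, so the whole segment stays where the speed bound holds.
  refine ⟨Metric.ball y r, Metric.ball_mem_nhds y hr, {d | W d}, hW, ?_⟩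
  intro a ha d hd ε hε hb
  set η : ℝ → EuclideanSpace ℝ (Fin n) := fun s ↦ a + s • (ε • d) with hη
  have hmem : ∀ s ∈ Icc (0 : ℝ) 1, η s ∈ Metric.ball y r := fun s hs ↦
    (convex_ball y r).add_smul_mem ha hb hs
  have htgt : ∀ s ∈ Icc (0 : ℝ) 1, η s ∈ (extChartAt (𝓡 n) c).target := fun s hs ↦
    (hball (hmem s hs)).2
  have hηs : ContDiff ℝ ∞ η := by fun_prop
  have hsm : ContMDiffOn 𝓘(ℝ, ℝ) (𝓡 n) 1 ((extChartAt (𝓡 n) c).symm ∘ η) (Icc 0 1) :=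
    ((contMDiffOn_extChartAt_symm (n := ∞) c).comp hηs.contMDiff.contMDiffOn htgt).of_le
      (by norm_cast)
  have hle := riemannianEDist_le_pathELength hsm rfl rfl zero_le_one
  rw [← IsRiemannianManifold.out (I := 𝓡 n)] at hle
  simp only [Function.comp, hη, zero_smul, add_zero, one_smul] at hle
  refine hle.trans ?_
  rw [pathELength_eq_lintegral_mfderivWithin_Icc]
  have hbound : ∀ s ∈ Icc (0 : ℝ) 1,
      ‖(mfderivWithin 𝓘(ℝ, ℝ) (𝓡 n) ((extChartAt (𝓡 n) c).symm ∘ η) (Icc 0 1) s (1 : ℝ) :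
        TangentSpace (𝓡 n) ((extChartAt (𝓡 n) c).symm (η s)))‖ₑ ≤ ENNReal.ofReal (ε * K) := by
    intro s hs
    have hu : UniqueDiffWithinAt ℝ (Icc (0 : ℝ) 1) s := uniqueDiffOn_Icc zero_lt_one s hs
    have h1 : MDifferentiableWithinAt 𝓘(ℝ, ℝ) (𝓡 n) η (Icc 0 1) s :=
      hηs.contMDiff.contMDiffOn.mdifferentiableOn (by simp) s hs
    have h2 : MDifferentiableAt (𝓡 n) (𝓡 n) (extChartAt (𝓡 n) c).symm (η s) :=
      ((contMDiffOn_extChartAt_symm (I := 𝓡 n) (n := ∞) c).contMDiffAt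
        ((isOpen_extChartAt_target c).mem_nhds (htgt s hs))).mdifferentiableAt (by simp)
    have h3 := mfderiv_comp_mfderivWithin s h2 h1 hu.uniqueMDiffWithinAt
    have h4 : mfderivWithin 𝓘(ℝ, ℝ) (𝓡 n) η (Icc 0 1) s (1 : ℝ) = ε • d := by
      rw [mfderivWithin_eq_fderivWithin]
      refine fderivWithin_derivWithin.trans ?_
      have : HasDerivAt η (ε • d) s := by
        exact (((hasDerivAt_id s).smul_const (ε • d)).const_add a).congr_deriv (one_smul ℝ _)
      exact this.hasDerivWithinAt.derivWithin hu
    have h5 : (mfderivWithin 𝓘(ℝ, ℝ) (𝓡 n) ((extChartAt (𝓡 n) c).symm ∘ η) (Icc 0 1) s (1 : ℝ) :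
        TangentSpace (𝓡 n) ((extChartAt (𝓡 n) c).symm (η s)))
        = mfderiv (𝓡 n) (𝓡 n) (extChartAt (𝓡 n) c).symm (η s) (ε • d) := by
      rw [← h4]
      exact congrArg (fun L : ℝ →L[ℝ] EuclideanSpace ℝ (Fin n) ↦ L 1) h3
    rw [h5, ← ofReal_norm]
    refine ENNReal.ofReal_le_ofReal (le_of_sq_le_sq ?_ (by positivity))
    rw [norm_mfderiv_symm_sq, chartNormSq_smul, mul_pow]
    have := hUW (hball (hmem s hs)).1 hd
    gcongr
  refine (setLIntegral_mono' measurableSet_Icc hbound).trans ?_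
  simp

/-- The distance between two curves issued from the same point is at most the length of the
difference of their velocities, to first order. -/
theorem sq_le_chartNormSq_sub {α β : ℝ → M} {c : M} {A B : EuclideanSpace ℝ (Fin n)} {S : ℝ}
    (hα : HasDerivWithinAt (coordCurve c α) A (Ioi 0) 0)
    (hβ : HasDerivWithinAt (coordCurve c β) B (Ioi 0) 0) (hα0 : α 0 = c) (hβ0 : β 0 = c)
    (hαs : ∀ᶠ ε in 𝓝[>] 0, α ε ∈ (extChartAt (𝓡 n) c).source)
    (hβs : ∀ᶠ ε in 𝓝[>] 0, β ε ∈ (extChartAt (𝓡 n) c).source) (hS : 0 ≤ S)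
    (hdist : ∀ᶠ ε in 𝓝[>] 0, ε * S ≤ dist (α ε) (β ε)) :
    S ^ 2 ≤ chartNormSq c (extChartAt (𝓡 n) c c) (B - A) := by
  by_contra! hlt
  have hq := Real.sqrt_lt_sqrt (chartNormSq_nonneg c _ _) hlt
  rw [Real.sqrt_sq hS] at hq
  -- A constant strictly between the two lengths absorbs the first-order error.
  obtain ⟨K, hqK, hKS⟩ := exists_between hq
  have hK : 0 < K := (Real.sqrt_nonneg _).trans_lt hqK
  obtain ⟨U, hU, W, hW, hUW⟩ := exists_edist_extChartAt_symm_le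
    (mem_extChartAt_target (I := 𝓡 n) c) hK ((Real.sqrt_lt' hK).1 hqK)
  have hαy : coordCurve (n := n) c α 0 = extChartAt (𝓡 n) c c := by rw [coordCurve, hα0]
  have hβy : coordCurve (n := n) c β 0 = extChartAt (𝓡 n) c c := by rw [coordCurve, hβ0]
  have df : Tendsto (fun ε ↦ ε⁻¹ • (coordCurve (n := n) c β ε - coordCurve c α ε)) (𝓝[>] 0)
      (𝓝 (B - A)) := by
    have h := hβ.sub hα
    rw [hasDerivWithinAt_iff_tendsto_slope' (by simp)] at h
    refine h.congr fun ε ↦ ?_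
    simp [slope, hαy, hβy]
  have ha := hα.continuousWithinAt
  have hb := hβ.continuousWithinAt
  rw [ContinuousWithinAt, hαy] at ha
  rw [ContinuousWithinAt, hβy] at hb
  have hpos : ∀ᶠ ε : ℝ in 𝓝[>] 0, ε ∈ Ioi (0 : ℝ) := self_mem_nhdsWithin
  obtain ⟨ε, hε, hεW, hεa, hεb, h1, h2, h3⟩ := (hpos.and
    ((df.eventually_mem hW).and ((ha.eventually_mem hU).and ((hb.eventually_mem hU).and
    (hαs.and (hβs.and hdist)))))).exists
  have hε0 : (0 : ℝ) < ε := hε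
  -- The direction of the segment is the difference quotient, which tends to `B - A` and so lies in
  -- `W`.
  have e : coordCurve c α ε + ε • ε⁻¹ • (coordCurve c β ε - coordCurve c α ε)
      = coordCurve (n := n) c β ε := by
    rw [smul_inv_smul₀ hε0.ne']
    abel
  have h := hUW _ hεa _ hεW ε hε0 (by rw [e]; exact hεb)
  rw [e, coordCurve, coordCurve, (extChartAt (𝓡 n) c).left_inv h1,
    (extChartAt (𝓡 n) c).left_inv h2, edist_dist,
    ENNReal.ofReal_le_ofReal_iff (by positivity)] at h
  exact absurd (h3.trans h) (not_le.2 (mul_lt_mul_of_pos_left hKS hε0))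

theorem IsMinimizingGeodesic.chartNormSq_derivWithin {γ : ℝ → M} {p x c : M} {t : ℝ}
    (h : IsMinimizingGeodesic n γ p x) (ht : t ∈ Icc (0 : ℝ) 1)
    (hs : γ t ∈ (extChartAt (𝓡 n) c).source) :
    chartNormSq c (coordCurve c γ t) (derivWithin (coordCurve (n := n) c γ) (Icc 0 1) t)
      = dist p x ^ 2 := by
  rw [← norm_mfderivWithin_sq h.isGeodesic.smooth ht hs, ← h.norm_velocity_zero,
    ← h.isGeodesic.norm_velocity ht]
  rfl

/-- Two minimizing geodesics issued from `p` cannot form a corner: at an interior point of the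
first one, the second one arrives with the same direction. -/
theorem IsMinimizingGeodesic.derivWithin_coordCurve_eq {γ τ : ℝ → M} {p x : M} {b : ℝ}
    (hγ : IsMinimizingGeodesic n γ p x) (hb : b ∈ Ioo (0 : ℝ) 1)
    (hτ : IsMinimizingGeodesic n τ p (γ b)) :
    derivWithin (coordCurve (n := n) (γ b) τ) (Icc 0 1) 1
      = b • derivWithin (coordCurve (n := n) (γ b) γ) (Icc 0 1) b := by
  obtain ⟨c, hc⟩ : ∃ c, c = γ b := ⟨_, rfl⟩
  rw [← hc] at hτ ⊢
  obtain ⟨A, hA⟩ : ∃ A, A = derivWithin (coordCurve (n := n) c τ) (Icc 0 1) 1 := ⟨_, rfl⟩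
  obtain ⟨B, hB⟩ : ∃ B, B = derivWithin (coordCurve (n := n) c γ) (Icc 0 1) b := ⟨_, rfl⟩
  rw [← hA, ← hB]
  have hbI : b ∈ Icc (0 : ℝ) 1 := Ioo_subset_Icc_self hb
  have h1I : (1 : ℝ) ∈ Icc (0 : ℝ) 1 := right_mem_Icc.2 zero_le_one
  have hsγ : γ b ∈ (extChartAt (𝓡 n) c).source := by
    rw [← hc]
    exact mem_extChartAt_source c
  have hsτ : τ 1 ∈ (extChartAt (𝓡 n) c).source := by
    rw [hτ.target]
    exact mem_extChartAt_source c
  have hpc : dist p c = b * dist p x := by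
    rw [hc]
    exact hγ.dist_source hbI
  have hQA : chartNormSq c (extChartAt (𝓡 n) c c) A = (b * dist p x) ^ 2 := by
    have h := hτ.chartNormSq_derivWithin h1I hsτ
    rwa [coordCurve, hτ.target, hpc, ← hA] at h
  have hQB : chartNormSq c (extChartAt (𝓡 n) c c) (b • B) = (b * dist p x) ^ 2 := by
    have h := hγ.chartNormSq_derivWithin hbI hsγ
    rw [coordCurve, ← hc, ← hB] at h
    rw [chartNormSq_smul, h, mul_pow]
  have hL0 : 0 ≤ b * dist p x := mul_nonneg hb.1.le dist_nonneg
  have mτ : Tendsto (fun ε : ℝ ↦ 1 - ε) (𝓝[>] 0) (𝓝[Icc 0 1] 1) := by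
    refine tendsto_nhdsWithin_iff.2 ⟨?_, ?_⟩
    · have : Tendsto (fun ε : ℝ ↦ 1 - ε) (𝓝 0) (𝓝 (1 - 0)) := tendsto_id.const_sub 1
      simpa using this.mono_left nhdsWithin_le_nhds
    · filter_upwards [Ioo_mem_nhdsGT (zero_lt_one (α := ℝ))] with ε hε
      exact ⟨by linarith [hε.2], by linarith [hε.1]⟩
  have mγ : Tendsto (fun ε : ℝ ↦ b + b * ε) (𝓝[>] 0) (𝓝[Icc 0 1] b) := by
    have h0 : Tendsto (fun ε : ℝ ↦ b + b * ε) (𝓝[>] 0) (𝓝 b) := by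
      have : Tendsto (fun ε : ℝ ↦ b + b * ε) (𝓝 0) (𝓝 (b + b * 0)) :=
        (tendsto_id.const_mul b).const_add b
      simpa using this.mono_left nhdsWithin_le_nhds
    exact tendsto_nhdsWithin_iff.2 ⟨h0, h0 (Icc_mem_nhds hb.1 hb.2)⟩
  have dγ : HasDerivWithinAt (coordCurve (n := n) c fun ε ↦ γ (b + b * ε)) (b • B) (Ioi 0) 0 := by
    have h := (hγ.isGeodesic.isPhaseCurve.position c b hbI hsγ).hasDerivAt
      (Icc_mem_nhds hb.1 hb.2)
    rw [← hB] at h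
    have h' : HasDerivAt (fun ε : ℝ ↦ b + b * ε) b 0 := by
      simpa using ((hasDerivAt_id (0 : ℝ)).const_mul b).const_add b
    exact (HasDerivAt.scomp_of_eq (0 : ℝ) h h' (by simp)).hasDerivWithinAt
  have dτ : HasDerivWithinAt (coordCurve (n := n) c fun ε ↦ τ (1 - ε)) (-A) (Ioi 0) 0 := by
    have h := (hτ.isGeodesic.isPhaseCurve.position c 1 h1I hsτ).mono_of_mem_nhdsWithin
      (Icc_mem_nhdsLE zero_lt_one)
    rw [← hA] at h
    have h' : HasDerivWithinAt (fun ε : ℝ ↦ 1 - ε) (-1) (Ioi 0) 0 := by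
      simpa using ((hasDerivAt_id (0 : ℝ)).const_sub 1).hasDerivWithinAt
    refine (HasDerivWithinAt.scomp_of_eq (0 : ℝ) h h' ?_ (by simp)).congr_deriv (neg_one_smul ℝ A)
    exact fun ε hε ↦ sub_le_self (1 : ℝ) (le_of_lt (mem_Ioi.1 hε))
  -- The factor `b` in `b + b * ε` gives both curves the speed `b * dist p x`. One recedes from `p`
  -- and the other approaches it, hence the factor `2`.
  have hQ : (2 * (b * dist p x)) ^ 2 ≤ chartNormSq c (extChartAt (𝓡 n) c c) (b • B - -A) := by
    refine sq_le_chartNormSq_sub dτ dγ (by simp [hτ.target]) (by simp [hc])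
      (mτ (hτ.isGeodesic.isPhaseCurve.eventually_mem_source h1I hsτ))
      (mγ (hγ.isGeodesic.isPhaseCurve.eventually_mem_source hbI hsγ)) (by positivity) ?_
    filter_upwards [mτ self_mem_nhdsWithin, mγ self_mem_nhdsWithin] with ε h1 h2
    have e1 := hτ.dist_source h1
    have e2 := hγ.dist_source h2
    have e3 := dist_triangle p (τ (1 - ε)) (γ (b + b * ε))
    rw [e1, e2, hpc] at e3
    linarith
  have hpar := chartNormSq_parallelogram c (extChartAt (𝓡 n) c c) (b • B) A
  rw [sub_neg_eq_add] at hQ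
  have h0 : chartNormSq c (extChartAt (𝓡 n) c c) (b • B - A) = 0 :=
    le_antisymm (by linarith) (chartNormSq_nonneg c _ _)
  exact (sub_eq_zero.1 (eq_zero_of_chartNormSq_eq_zero (mem_extChartAt_target c) h0)).symm

/-- A minimizing geodesic from `p` to an interior point of another one is a part of it. -/
theorem IsMinimizingGeodesic.apply_eq {γ τ : ℝ → M} {p x : M} {b l : ℝ}
    (hγ : IsMinimizingGeodesic n γ p x) (hb : b ∈ Ioo (0 : ℝ) 1)
    (hτ : IsMinimizingGeodesic n τ p (γ b)) (hl : l ∈ Icc (0 : ℝ) 1) : τ l = γ (l * b) := by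
  have m1 : MapsTo (fun t : ℝ ↦ -1 * t + 1) (Icc 0 1) (Icc 0 1) := fun t ht ↦
    ⟨by linarith [ht.2], by linarith [ht.1]⟩
  have m2 : MapsTo (fun t : ℝ ↦ -b * t + b) (Icc 0 1) (Icc 0 1) := fun t ht ↦
    ⟨by nlinarith [ht.2, hb.1], by nlinarith [ht.1, hb.1, hb.2]⟩
  -- Both curves are run backwards from `γ b`, where position and velocity are known to match, and
  -- are compared at time `1 - l`.
  have h := (hτ.isGeodesic.isPhaseCurve.comp_affine m1).eqOn
    (hγ.isGeodesic.isPhaseCurve.comp_affine m2) (by simp [hτ.target])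
    (by simp [hτ.target, hγ.derivWithin_coordCurve_eq hb hτ])
    (⟨by linarith [hl.2], by linarith [hl.1]⟩ : 1 - l ∈ Icc (0 : ℝ) 1)
  convert h using 2 <;> ring

end Corners

end RadialContraction

end

theorem mainTheorem5 {n : ℕ} {M : Type*} [MetricSpace M] [CompleteSpace M]
    [ChartedSpace (EuclideanSpace ℝ (Fin n)) M] [IsManifold (𝓡 n) ∞ M]
    [Bundle.RiemannianBundle (fun x : M ↦ TangentSpace (𝓡 n) x)]
    [IsContMDiffRiemannianBundle (𝓡 n) ∞ (EuclideanSpace ℝ (Fin n))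
      (fun x : M ↦ TangentSpace (𝓡 n) x)]
    [IsRiemannianManifold (𝓡 n) M]
    (p : M) (η : RadialContraction.DirectionFunction n p)
    (l b : ℝ) (hl : l ∈ Set.Ioc (0 : ℝ) 1) (hb : b ∈ Set.Ioc (0 : ℝ) 1) (x : M) :
    RadialContraction.radialContraction η l (RadialContraction.radialContraction η b x) =
      RadialContraction.radialContraction η (l * b) x := by
  simp only [RadialContraction.radialContraction]
  have hγ := (η.geodesic_spec x).1
  rcases hb.2.eq_or_lt with rfl | hb1
  -- The intermediate point is `x` itself, so `η` selects the same geodesic again.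
  · rw [hγ.target, mul_one]
  · exact hγ.apply_eq ⟨hb.1, hb1⟩ (η.geodesic_spec _).1 ⟨hl.1.le, hl.2⟩
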